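/- Let $X$ and $Y$ be reflexive real Banach spaces with topological duals $X'$ and $Y'$, and suppose that $Y'\subset X'$ with continuous inclusion. A map $B:X\to X'$ is called monotone if $\langle B(u+h)-B(u),h\rangle\ge 0$ for all $u,h\in X$. For Banach spaces $E,H$, a map $G_T:E\to\mathcal L(E,H)$ is called a Newton derivative of $T:E\to H$ if, for every $u\in E$, $$\lim_{h\to 0}\frac{\|T(u+h)-T(u)-G_T(u+h)h\|_H}{\|h\|_E}=0,$$ and $T$ is called Newton differentiable if it has a Newton derivative. Let $A:X\to X'$ be continuously Fréchet differentiable with Fréchet derivative $A'$, and suppose that 1. there is $c>0$ with $\langle A(u+h)-A(u),h\rangle\ge c\|h\|_X^2$ for all $u,h\in X$; 2. there are a map $w:X\times X\to X'$ and a constant $M$ such that for every $u\in X$ there is $r=r(u)>0$ such that, for all $h\in X$ with $\|h\|_X<r$, $$\langle A(u+h)-A(u),h\rangle=\langle A'(u)h,h\rangle+\langle w(u,h),h\rangle,\qquad \|w(u,h)\|_{X'}\le M\|h\|_X^2 .$$ Let $F:X\to X'$ be monotone, continuous and Newton differentiable with Newton derivative $G_F:X\to\mathcal L(X,X')$, and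 suppose that either $v\mapsto\langle G_F(v)h,h\rangle$ is continuous on $X$ for each $h\in X$, or $G_F(u):X\to X'$ is monotone for each $u\in X$. Then for each $f\in Y'$ the equation $A(u)+F(u)=f$ in $X'$ has a unique solution $u=u(f)\in X$. Moreover, for all $f,h\in Y'$ the equation $$A'(u(f))w+G_F(u(f))w=h\quad\text{in }X'$$ has a unique solution $w\in X$; setting $G_u(f)h:=w$ defines an operator $G_u(f)\in\mathcal L(Y',X)$, and the map $Y'\ni f\mapsto u(f)\in X$ is Newton differentiable with Newton derivative $f\mapsto G_u(f)$. -/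

import Mathlib

open Filter Topology

/-- A real normed space is reflexive if the canonical isometric embedding into its
(topological) bidual is onto. -/
def IsReflexiveSpace (E : Type*) [NormedAddCommGroup E] [NormedSpace ℝ E] : Prop :=
  Function.Surjective (NormedSpace.inclusionInDoubleDual ℝ E)

/-- `F : X → X'` is monotone: `⟨F (u + h) - F u, h⟩ ≥ 0` for all `u, h`. -/
def IsMonotoneOperator {X : Type*} [NormedAddCommGroup X] [NormedSpace ℝ X]
    (F : X → StrongDual ℝ X) : Prop :=
  ∀ u h : X, 0 ≤ (F (u + h) - F u) h

/-- `A : X → X'` is strongly monotone with exponent `q`: for some `c > 0`,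
`⟨A (u + h) - A u, h⟩ ≥ c ‖h‖ ^ q` for all `u, h`. -/
def IsStronglyMonotoneOperator {X : Type*} [NormedAddCommGroup X] [NormedSpace ℝ X]
    (A : X → StrongDual ℝ X) (q : ℝ) : Prop :=
  ∃ c : ℝ, 0 < c ∧ ∀ u h : X, c * ‖h‖ ^ q ≤ (A (u + h) - A u) h

/-- The second-order remainder bound for `A : X → X'`: there are a map `w` and a constant `M`
such that for every `u` and all `h` in a ball of radius `r = r(u) > 0` around `0`,
`⟨A (u + h) - A u, h⟩ = ⟨A'(u) h, h⟩ + ⟨w (u, h), h⟩` and `‖w (u, h)‖ ≤ M ‖h‖ ^ 2`. -/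
def HasSecondOrderRemainderBound {X : Type*} [NormedAddCommGroup X] [NormedSpace ℝ X]
    (A : X → StrongDual ℝ X) : Prop :=
  ∃ (w : X → X → StrongDual ℝ X) (M : ℝ), ∀ u : X, ∃ r : ℝ, 0 < r ∧
    ∀ h ∈ Metric.ball (0 : X) r,
      (A (u + h) - A u) h = fderiv ℝ A u h h + w u h h ∧ ‖w u h‖ ≤ M * ‖h‖ ^ 2

/-- `G : E → 𝓛(E, H)` is a Newton derivative of `F : E → H` on the whole space `E`: at every
point `u`, `‖F (u + h) - F u - G (u + h) h‖ / ‖h‖ → 0` as `h → 0`, `h ≠ 0`. -/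
def HasNewtonDerivative {E H : Type*} [NormedAddCommGroup E] [NormedSpace ℝ E]
    [NormedAddCommGroup H] [NormedSpace ℝ H] (F : E → H) (G : E → E →L[ℝ] H) : Prop :=
  ∀ u : E, Tendsto (fun h : E => ‖F (u + h) - F u - G (u + h) h‖ / ‖h‖) (𝓝[≠] 0) (𝓝 0)

/-! The sum `A + F` is continuous and strongly monotone with the constant `c` of `A`, so it is a
bijection onto the dual with `c⁻¹`-Lipschitz inverse (Browder–Minty,
`exists_eq_of_stronglyMonotone`). Each linearization `A'(u) + GF u` is coercive with the same `c`:
the first term inherits it from `A`, and the second is nonnegative. The inverses are thus bounded by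
`c⁻¹` uniformly in `u`.

For the Newton derivative put `k = S (f + h) - S f`. Applying the linearization at the new point `S
(f + h)` to the error leaves only the Newton remainders of `A` and `F`, which are `o(‖k‖)`, hence
`o(‖h‖)` since `S` is Lipschitz. -/

theorem exists_mem_stdSimplex_forall_sum_nonneg {n : Type*} [Fintype n] [Nonempty n]
    (M : n → n → ℝ) (hM : ∀ i j, 0 ≤ M i j + M j i) :
    ∃ l ∈ stdSimplex ℝ n, ∀ i, 0 ≤ ∑ j, M i j * l j := by
  classical
  by_contra! hcon
  let L : (n → ℝ) →ₗ[ℝ] (n → ℝ) := Matrix.mulVecLin (Matrix.of M)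
  have hL : ∀ l i, L l i = ∑ j, M i j * l j := fun l i => rfl
  have hLc : Continuous L := L.continuous_of_finiteDimensional
  -- If no such point exists, the image of the simplex misses the nonnegative orthant. A separating
  -- functional is a nonzero nonnegative vector `μ`; rescaled into the simplex it makes the
  -- quadratic form of `M` negative, against the hypothesis on the symmetric part.
  obtain ⟨φ, s, t, hs, hst, ht⟩ := geometric_hahn_banach_compact_closed
    (s := L '' stdSimplex ℝ n) (t := {y : n → ℝ | ∀ i, 0 ≤ y i})
    ((convex_stdSimplex ℝ n).linear_image L) ((isCompact_stdSimplex ℝ n).image hLc)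
    (fun x hx y hy a b ha hb _ i => by
      have := mul_nonneg ha (hx i)
      have := mul_nonneg hb (hy i)
      simp only [Pi.add_apply, Pi.smul_apply, smul_eq_mul]
      linarith)
    (by
      simp only [Set.ofPred_forall]
      exact isClosed_iInter fun i => isClosed_le continuous_const (continuous_apply i))
    (by
      rw [Set.disjoint_left]
      rintro _ ⟨l, hl, rfl⟩ hmem
      obtain ⟨i, hi⟩ := hcon l hl
      exact absurd (hmem i) (by rw [hL]; exact not_le.2 hi))
  have ht0 : t < 0 := by simpa using ht 0 (fun i => le_rfl)
  have hμ : ∀ i, 0 ≤ φ (Pi.single i 1) := by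
    intro i
    by_contra! hneg
    have hk : 0 ≤ t / φ (Pi.single i 1) := div_nonneg_of_nonpos ht0.le hneg.le
    have := ht ((t / φ (Pi.single i 1)) • Pi.single i 1) (fun j => by
      by_cases hj : j = i
      · subst hj; simpa using hk
      · simp [hj])
    rw [map_smul, smul_eq_mul, div_mul_cancel₀ _ hneg.ne] at this
    exact lt_irrefl _ this
  set μ : n → ℝ := fun i => φ (Pi.single i 1) with hμdef
  have hφ : ∀ y : n → ℝ, φ y = ∑ i, y i * μ i := by
    intro y
    conv_lhs => rw [pi_eq_sum_univ' y]
    simp only [map_sum, map_smul, smul_eq_mul, hμdef]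
  have hneg : ∀ l ∈ stdSimplex ℝ n, φ (L l) < 0 := fun l hl =>
    (hs _ ⟨l, hl, rfl⟩).trans (hst.trans ht0)
  have hsum : 0 < ∑ i, μ i := by
    refine lt_of_le_of_ne (Finset.sum_nonneg fun i _ => hμ i) fun h0 => ?_
    have hz := (Finset.sum_eq_zero_iff_of_nonneg fun i _ => hμ i).1 h0.symm
    have := hneg _ (single_mem_stdSimplex ℝ (Classical.arbitrary n))
    rw [hφ, Finset.sum_eq_zero fun i hi => mul_eq_zero_of_right _ (hz i hi)] at this
    exact lt_irrefl _ this
  have h1 := hneg ((∑ i, μ i)⁻¹ • μ) ⟨fun i => mul_nonneg (inv_nonneg.2 hsum.le) (hμ i), by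
    simp [← Finset.mul_sum, hsum.ne']⟩
  rw [map_smul, map_smul, smul_eq_mul] at h1
  have h2 : φ (L μ) < 0 := by
    by_contra! h
    exact absurd h1 (not_lt.2 (mul_nonneg (inv_nonneg.2 hsum.le) h))
  have h3 : φ (L μ) = ∑ i, ∑ j, M i j * μ j * μ i := by
    rw [hφ]
    simp only [hL, Finset.sum_mul]
  have h4 : φ (L μ) = ∑ i, ∑ j, M j i * μ j * μ i := by
    rw [h3, Finset.sum_comm]
    exact Finset.sum_congr rfl fun i _ => Finset.sum_congr rfl fun j _ => by ring
  have h5 : φ (L μ) + φ (L μ) = ∑ i, ∑ j, (M i j + M j i) * (μ j * μ i) := by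
    nth_rewrite 1 [h3]
    rw [h4, ← Finset.sum_add_distrib]
    refine Finset.sum_congr rfl fun i _ => ?_
    rw [← Finset.sum_add_distrib]
    exact Finset.sum_congr rfl fun j _ => by ring
  have h6 : 0 ≤ φ (L μ) + φ (L μ) := by
    rw [h5]
    exact Finset.sum_nonneg fun i _ => Finset.sum_nonneg fun j _ =>
      mul_nonneg (hM i j) (mul_nonneg (hμ j) (hμ i))
  linarith

/-! ### Browder–Minty theorem in a reflexive space. -/

section Monotone

variable {X : Type*} [NormedAddCommGroup X] [NormedSpace ℝ X]

/-- The point is a convex combination of `s`. The matrix `⟨B i - f, i - j⟩` has symmetrization `⟨B i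
- B j, i - j⟩`, in which `f` cancels and monotonicity applies. -/
theorem IsMonotoneOperator.exists_mem_closedBall_finset {B : X → StrongDual ℝ X}
    (hB : IsMonotoneOperator B) (f : StrongDual ℝ X) {R : ℝ} (hR : 0 ≤ R) (s : Finset X)
    (hs : ∀ v ∈ s, ‖v‖ ≤ R) :
    ∃ u : X, ‖u‖ ≤ R ∧ ∀ v ∈ s, 0 ≤ (B v - f) (v - u) := by
  classical
  rcases s.eq_empty_or_nonempty with rfl | hne
  · exact ⟨0, by simpa using hR, by simp⟩
  have : Nonempty s := hne.to_subtype
  obtain ⟨l, hl, h⟩ := exists_mem_stdSimplex_forall_sum_nonneg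
    (fun i j : s => (B i - f) ((i : X) - j)) (fun i j => by
      have := hB j (i - j)
      rw [add_sub_cancel] at this
      have e : (B i - f) ((i : X) - j) + (B j - f) ((j : X) - i) = (B i - B j) ((i : X) - j) := by
        simp only [sub_apply, map_sub]
        ring
      rwa [e])
  refine ⟨∑ j, l j • (j : X), ?_, fun v hv => ?_⟩
  · have := (convex_closedBall (0 : X) R).sum_mem (t := Finset.univ) (w := l)
      (z := fun j : s => (j : X)) (fun i _ => hl.1 i) hl.2
      (fun i _ => by simpa using hs i i.2)
    simpa using this
  · have := h ⟨v, hv⟩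
    have e : v - ∑ j, l j • (j : X) = ∑ j, l j • (v - (j : X)) := by
      simp only [smul_sub, Finset.sum_sub_distrib, ← Finset.sum_smul, hl.2, one_smul]
    rw [e, map_sum]
    simpa only [map_smul, smul_eq_mul, mul_comm] using this

/-- Each `v` cuts out a weak-* closed half-space of the bidual. Banach–Alaoglu passes from finitely
many `v` to all, and reflexivity brings the point back to `X`. -/
theorem IsMonotoneOperator.exists_mem_closedBall {B : X → StrongDual ℝ X}
    (hX : IsReflexiveSpace X) (hB : IsMonotoneOperator B) (f : StrongDual ℝ X)
    {R : ℝ} (hR : 0 ≤ R) :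
    ∃ u : X, ‖u‖ ≤ R ∧ ∀ v : X, ‖v‖ ≤ R → 0 ≤ (B v - f) (v - u) := by
  have hcpt := WeakDual.isCompact_closedBall (𝕜 := ℝ) (E := StrongDual ℝ X) 0 R
  obtain ⟨ξ, hξR, hξ⟩ := hcpt.inter_iInter_nonempty
    (fun v : Metric.closedBall (0 : X) R =>
      {ξ : WeakDual ℝ (StrongDual ℝ X) | ξ (B v - f) ≤ (B v - f) v})
    (fun v => isClosed_le (WeakDual.eval_continuous _) continuous_const)
    (fun s => by
      classical
      obtain ⟨u, hu, h⟩ := hB.exists_mem_closedBall_finset f hR (s.image Subtype.val) (by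
        intro v hv
        obtain ⟨w, -, rfl⟩ := Finset.mem_image.1 hv
        exact mem_closedBall_zero_iff.1 w.2)
      refine ⟨StrongDual.toWeakDual (NormedSpace.inclusionInDoubleDual ℝ X u), ?_, ?_⟩
      · simp only [Set.mem_preimage, mem_closedBall_zero_iff]
        exact ((NormedSpace.double_dual_bound ℝ X u).trans hu)
      · simp only [Set.mem_iInter, Set.mem_ofPred_eq]
        intro v hv
        have := h v (Finset.mem_image_of_mem _ hv)
        rw [map_sub, sub_nonneg] at this
        exact this)
  obtain ⟨u, hu⟩ := hX (WeakDual.toStrongDual ξ)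
  refine ⟨u, ?_, fun v hv => ?_⟩
  · rw [Set.mem_preimage, mem_closedBall_zero_iff, ← hu] at hξR
    exact ((NormedSpace.inclusionInDoubleDualLi ℝ (E := X)).norm_map u).symm.le.trans hξR
  have h := Set.mem_iInter.1 hξ ⟨v, by simpa using hv⟩
  have e : ξ (B v - f) = (B v - f) u := by
    have := DFunLike.congr_fun hu (B v - f)
    exact this.symm
  rw [map_sub, sub_nonneg, ← e]
  exact h

/-- Minty's trick: `v = u + t • k` is admissible for small `t > 0` because `u` is interior; divide
by `t` and let `t → 0`. -/
theorem eq_of_forall_nonneg_sub_apply {B : X → StrongDual ℝ X} (hBc : Continuous B)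
    {f : StrongDual ℝ X} {R : ℝ} {u : X} (hu : ‖u‖ < R)
    (h : ∀ v : X, ‖v‖ ≤ R → 0 ≤ (B v - f) (v - u)) : B u = f := by
  have key : ∀ k : X, 0 ≤ (B u - f) k := by
    intro k
    have hc : Continuous fun t : ℝ => u + t • k := by fun_prop
    have hlim : Tendsto (fun t : ℝ => (B (u + t • k) - f) k) (𝓝[>] 0) (𝓝 ((B u - f) k)) := by
      have : Continuous fun t : ℝ => (B (u + t • k) - f) k :=
        ((hBc.comp hc).sub continuous_const).clm_apply continuous_const
      simpa using (this.tendsto 0).mono_left nhdsWithin_le_nhds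
    refine ge_of_tendsto hlim ?_
    have h1 : ∀ᶠ t : ℝ in 𝓝[>] 0, ‖u + t • k‖ < R :=
      nhdsWithin_le_nhds (hc.norm.continuousAt.eventually_lt continuousAt_const (by simpa using hu))
    filter_upwards [h1, self_mem_nhdsWithin] with t ht ht0
    have := h _ ht.le
    rw [add_sub_cancel_left, map_smul, smul_eq_mul] at this
    exact nonneg_of_mul_nonneg_right this ht0
  rw [← sub_eq_zero]
  ext k
  have h1 := key k
  have h2 := key (-k)
  rw [map_neg] at h2
  simp only [zero_apply]
  linarith

theorem norm_le_div_of_mul_sq_le_apply {c : ℝ} (hc : 0 < c) {k : X} {g : StrongDual ℝ X}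
    (h : c * ‖k‖ ^ 2 ≤ g k) : ‖k‖ ≤ c⁻¹ * ‖g‖ := by
  rw [inv_mul_eq_div, le_div_iff₀ hc]
  have h1 : g k ≤ ‖g‖ * ‖k‖ := (le_abs_self _).trans (g.le_opNorm k)
  rcases (norm_nonneg k).eq_or_lt with h0 | h0
  · rw [← h0, zero_mul]; exact norm_nonneg g
  · refine le_of_mul_le_mul_right ?_ h0
    linarith

theorem exists_eq_of_stronglyMonotone (hX : IsReflexiveSpace X) {B : X → StrongDual ℝ X}
    (hBc : Continuous B) {c : ℝ} (hc : 0 < c)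
    (hB : ∀ u h : X, c * ‖h‖ ^ 2 ≤ (B (u + h) - B u) h) (f : StrongDual ℝ X) :
    ∃ u, B u = f := by
  have hmono : IsMonotoneOperator B := fun u h => le_trans (by positivity) (hB u h)
  set R : ℝ := 2 * (c⁻¹ * ‖f - B 0‖) + 1 with hR
  have hR0 : 0 ≤ R := by positivity
  obtain ⟨u, huR, hu⟩ := hmono.exists_mem_closedBall hX f hR0
  refine ⟨u, eq_of_forall_nonneg_sub_apply hBc (lt_of_le_of_ne huR fun hne => ?_) hu⟩
  -- Were `u` on the sphere, testing with `u / 2` would give `‖u‖ / 2 ≤ c⁻¹ * ‖f - B 0‖`, which the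
  -- choice of `R` excludes.
  set v : X := (1 / 2 : ℝ) • u with hv
  have hnv : ‖v‖ = ‖u‖ / 2 := by
    rw [hv, norm_smul, Real.norm_of_nonneg (by norm_num)]
    ring
  have hvu : v - u = -v := by
    rw [hv]
    module
  have h1 := hu v (by rw [hnv]; linarith [norm_nonneg u])
  have h2 := hB 0 v
  rw [zero_add] at h2
  rw [hvu, map_neg, sub_apply] at h1
  have h3 : ‖v‖ ≤ c⁻¹ * ‖f - B 0‖ := norm_le_div_of_mul_sq_le_apply hc (h2.trans (by
    simp only [sub_apply]
    linarith))
  linarith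

theorem eq_of_stronglyMonotone {B : X → StrongDual ℝ X} {c : ℝ} (hc : 0 < c)
    (hB : ∀ u h : X, c * ‖h‖ ^ 2 ≤ (B (u + h) - B u) h) {u v : X} (huv : B u = B v) :
    u = v := by
  have h := norm_le_div_of_mul_sq_le_apply hc (hB v (u - v))
  rw [add_sub_cancel, huv, sub_self, norm_zero, mul_zero, norm_le_zero_iff] at h
  exact sub_eq_zero.1 h

theorem exists_continuousLinearMap_rightInverse_of_coercive (hX : IsReflexiveSpace X)
    (T : X →L[ℝ] StrongDual ℝ X) {c : ℝ} (hc : 0 < c) (hT : ∀ h : X, c * ‖h‖ ^ 2 ≤ T h h) :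
    ∃ K : StrongDual ℝ X →L[ℝ] X, ∀ g, T (K g) = g := by
  have hT' : ∀ u h : X, c * ‖h‖ ^ 2 ≤ (T (u + h) - T u) h := fun u h => by
    rw [map_add, add_sub_cancel_left]
    exact hT h
  choose K hK using exists_eq_of_stronglyMonotone hX T.continuous hc hT'
  have hinj : ∀ {u v : X}, T u = T v → u = v := eq_of_stronglyMonotone hc hT'
  exact ⟨LinearMap.mkContinuous
    { toFun := K
      map_add' := fun f g => hinj (by rw [map_add, hK, hK, hK])
      map_smul' := fun a f => hinj (by rw [RingHom.id_apply, map_smul, hK, hK]) } c⁻¹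
    fun g => norm_le_div_of_mul_sq_le_apply hc (by
      have := hT (K g)
      rwa [hK] at this), hK⟩

/-! ### Linearizations and Newton derivatives. -/

theorem coercive_fderiv_of_stronglyMonotone {A : X → StrongDual ℝ X} {c : ℝ}
    (hA : ∀ u h : X, c * ‖h‖ ^ 2 ≤ (A (u + h) - A u) h) {u : X}
    (hd : DifferentiableAt ℝ A u) (h : X) : c * ‖h‖ ^ 2 ≤ fderiv ℝ A u h h := by
  have hlim := hd.hasFDerivAt.hasLineDerivAt h
  have h1 : Tendsto (fun t : ℝ => (t⁻¹ • (A (u + t • h) - A u)) h) (𝓝[≠] 0)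
      (𝓝 (fderiv ℝ A u h h)) :=
    ((ContinuousLinearMap.apply ℝ ℝ h).continuous.tendsto _).comp
      (hasLineDerivAt_iff_tendsto_slope_zero.1 hlim)
  refine ge_of_tendsto h1 ?_
  filter_upwards [self_mem_nhdsWithin] with t ht
  have ht' : 0 < t ^ 2 := sq_pos_of_ne_zero ht
  have h2 := hA u (t • h)
  rw [norm_smul, mul_pow, Real.norm_eq_abs, sq_abs, map_smul, smul_eq_mul] at h2
  have e : t ^ 2 * (t⁻¹ * (A (u + t • h) - A u) h) = t * (A (u + t • h) - A u) h := by
    field_simp [show t ≠ 0 from ht]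
  rw [smul_apply, smul_eq_mul]
  refine le_of_mul_le_mul_left ?_ ht'
  rw [e]
  linarith

theorem HasNewtonDerivative.exists_forall_norm_le {E H : Type*} [NormedAddCommGroup E]
    [NormedSpace ℝ E] [NormedAddCommGroup H] [NormedSpace ℝ H] {F : E → H} {G : E → E →L[ℝ] H}
    (hF : HasNewtonDerivative F G) (u : E) {ε : ℝ} (hε : 0 < ε) :
    ∀ᶠ h in 𝓝 (0 : E), ‖F (u + h) - F u - G (u + h) h‖ ≤ ε * ‖h‖ := by
  have h1 := (hF u).eventually (gt_mem_nhds hε)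
  rw [eventually_nhdsWithin_iff] at h1
  filter_upwards [h1] with h hh
  rcases eq_or_ne h 0 with rfl | h0
  · simp
  · exact ((div_lt_iff₀ (norm_pos_iff.2 h0)).1 (hh h0)).le

theorem hasNewtonDerivative_of_forall_norm_le {E H : Type*} [NormedAddCommGroup E]
    [NormedSpace ℝ E] [NormedAddCommGroup H] [NormedSpace ℝ H] {F : E → H} {G : E → E →L[ℝ] H}
    (hF : ∀ u : E, ∀ ε : ℝ, 0 < ε →
      ∀ᶠ h in 𝓝 (0 : E), ‖F (u + h) - F u - G (u + h) h‖ ≤ ε * ‖h‖) :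
    HasNewtonDerivative F G := by
  intro u
  rw [Metric.tendsto_nhds]
  intro ε hε
  filter_upwards [nhdsWithin_le_nhds (hF u (ε / 2) (half_pos hε))] with h hh
  rw [Real.dist_0_eq_abs, abs_of_nonneg (by positivity)]
  exact (div_le_of_le_mul₀ (norm_nonneg _) (half_pos hε).le hh).trans_lt (half_lt_self hε)

theorem ContDiff.hasNewtonDerivative_fderiv {E H : Type*} [NormedAddCommGroup E]
    [NormedSpace ℝ E] [NormedAddCommGroup H] [NormedSpace ℝ H] {A : E → H}
    (hA : ContDiff ℝ 1 A) : HasNewtonDerivative A (fderiv ℝ A) := by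
  refine hasNewtonDerivative_of_forall_norm_le fun u ε hε => ?_
  have h0 : Tendsto (fun h : E => u + h) (𝓝 0) (𝓝 u) := by
    simpa using (continuous_const_add u).tendsto (0 : E)
  have h1 : ∀ᶠ h in 𝓝 (0 : E), ‖A (u + h) - A u - fderiv ℝ A u h‖ ≤ ε / 2 * ‖h‖ :=
    (hasFDerivAt_iff_isLittleO_nhds_zero.1
      (hA.differentiable one_ne_zero u).hasFDerivAt).def (half_pos hε)
  have h2 : ∀ᶠ h in 𝓝 (0 : E), ‖fderiv ℝ A (u + h) - fderiv ℝ A u‖ < ε / 2 := by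
    simpa only [dist_eq_norm] using h0.eventually
      (((hA.continuous_fderiv one_ne_zero).tendsto u).eventually (Metric.ball_mem_nhds _ (half_pos hε)))
  filter_upwards [h1, h2] with h hh1 hh2
  have e : A (u + h) - A u - fderiv ℝ A (u + h) h =
      (A (u + h) - A u - fderiv ℝ A u h) - (fderiv ℝ A (u + h) - fderiv ℝ A u) h := by
    rw [sub_apply]
    abel
  have h3 := (fderiv ℝ A (u + h) - fderiv ℝ A u).le_of_opNorm_le hh2.le h
  rw [e]
  linarith [norm_sub_le (A (u + h) - A u - fderiv ℝ A u h)
    ((fderiv ℝ A (u + h) - fderiv ℝ A u) h)]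

/-- Along `t • h`, monotonicity and the Newton estimate give `G (u + t • h) h h ≥ -ε` after division
by `t ^ 2`; continuity then moves the base point to `u`. -/
theorem IsMonotoneOperator.newtonDerivative_nonneg {F : X → StrongDual ℝ X}
    {G : X → X →L[ℝ] StrongDual ℝ X} (hF : IsMonotoneOperator F) (hG : HasNewtonDerivative F G)
    {u h : X} (hc : ContinuousAt (fun v => G v h h) u) : 0 ≤ G u h h := by
  have h0 : Tendsto (fun t : ℝ => t • h) (𝓝[≠] 0) (𝓝 0) := by
    have : Continuous fun t : ℝ => t • h := by fun_prop
    simpa using (this.tendsto 0).mono_left nhdsWithin_le_nhds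
  have h1 : Tendsto (fun t : ℝ => G (u + t • h) h h) (𝓝[≠] 0) (𝓝 (G u h h)) := by
    refine Tendsto.comp hc ?_
    simpa using tendsto_const_nhds.add h0
  refine le_of_forall_pos_le_add fun ε hε => ?_
  have hδ : 0 < ε / (‖h‖ ^ 2 + 1) := by positivity
  refine ge_of_tendsto (h1.add_const ε) ?_
  filter_upwards [h0.eventually (hG.exists_forall_norm_le u hδ), self_mem_nhdsWithin] with t ht ht0
  have ht2 : 0 < t ^ 2 := sq_pos_of_ne_zero ht0
  have h2 := hF u (t • h)
  have h3 := (F (u + t • h) - F u - G (u + t • h) (t • h)).le_of_opNorm_le ht (t • h)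
  have h4 := (le_abs_self _).trans h3
  have h5 : ε / (‖h‖ ^ 2 + 1) * ‖h‖ ^ 2 ≤ ε := by
    rw [div_mul_eq_mul_div, div_le_iff₀ (by positivity)]
    nlinarith
  have h6 : ε / (‖h‖ ^ 2 + 1) * ‖t • h‖ * ‖t • h‖ = t ^ 2 * (ε / (‖h‖ ^ 2 + 1) * ‖h‖ ^ 2) := by
    rw [norm_smul, Real.norm_eq_abs, ← sq_abs t]
    ring
  have h7 : (F (u + t • h) - F u - G (u + t • h) (t • h)) (t • h) =
      (F (u + t • h) - F u) (t • h) - t ^ 2 * G (u + t • h) h h := by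
    rw [sub_apply, map_smul (G (u + t • h)), smul_apply, map_smul (G (u + t • h) h)]
    simp only [smul_eq_mul]
    ring
  rw [h6, h7] at h4
  have h8 := mul_le_mul_of_nonneg_left h5 ht2.le
  refine nonneg_of_mul_nonneg_right ?_ ht2
  linarith

end Monotone

/-! ### Solution map and its Newton derivative. -/

theorem mainTheorem1
    {X : Type*} [NormedAddCommGroup X] [NormedSpace ℝ X] [CompleteSpace X]
    (hX : IsReflexiveSpace X)
    {Y : Type*} [NormedAddCommGroup Y] [NormedSpace ℝ Y] [CompleteSpace Y]
    (hY : IsReflexiveSpace Y)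
    -- the continuous inclusion `Y' ⊂ X'`
    (ι : StrongDual ℝ Y →L[ℝ] StrongDual ℝ X) (hι : Function.Injective ι)
    (A : X → StrongDual ℝ X)
    (hA_diff : ContDiff ℝ 1 A)
    (hA_mono : IsStronglyMonotoneOperator A 2)
    (hA_rem : HasSecondOrderRemainderBound A)
    (F : X → StrongDual ℝ X) (GF : X → X →L[ℝ] StrongDual ℝ X)
    (hF_mono : IsMonotoneOperator F)
    (hF_cont : Continuous F)
    (hF_newton : HasNewtonDerivative F GF)
    (hGF : (∀ u h : X, ContinuousAt (fun v : X => GF v h h) u) ∨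
      (∀ u : X, IsMonotoneOperator (fun h : X => GF u h))) :
    ∃ (S : StrongDual ℝ Y → X) (GS : StrongDual ℝ Y → StrongDual ℝ Y →L[ℝ] X),
      (∀ f : StrongDual ℝ Y,
        A (S f) + F (S f) = ι f ∧ ∀ v : X, A v + F v = ι f → v = S f) ∧
      (∀ f h : StrongDual ℝ Y,
        fderiv ℝ A (S f) (GS f h) + GF (S f) (GS f h) = ι h ∧
          ∀ w : X, fderiv ℝ A (S f) w + GF (S f) w = ι h → w = GS f h) ∧
      HasNewtonDerivative S GS := by
  obtain ⟨c, hc, hA'⟩ := hA_mono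
  have hA : ∀ u h : X, c * ‖h‖ ^ 2 ≤ (A (u + h) - A u) h := fun u h => by
    simpa only [Real.rpow_two] using hA' u h
  have hB : ∀ u h : X, c * ‖h‖ ^ 2 ≤ ((A (u + h) + F (u + h)) - (A u + F u)) h := fun u h => by
    have h1 := hA u h
    have h2 := hF_mono u h
    rw [add_sub_add_comm, add_apply]
    linarith
  have hGF_nonneg : ∀ u h : X, 0 ≤ GF u h h := fun u h => by
    rcases hGF with hcont | hmono
    · exact hF_mono.newtonDerivative_nonneg hF_newton (hcont u h)
    · simpa using hmono u 0 h
  have hT : ∀ u h : X, c * ‖h‖ ^ 2 ≤ (fderiv ℝ A u + GF u) h h := fun u h => by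
    have h1 := coercive_fderiv_of_stronglyMonotone hA (hA_diff.differentiable one_ne_zero u) h
    rw [add_apply, add_apply]
    linarith [hGF_nonneg u h]
  have hT' : ∀ u v h : X,
      c * ‖h‖ ^ 2 ≤ ((fderiv ℝ A u + GF u) (v + h) - (fderiv ℝ A u + GF u) v) h := fun u v h => by
    rw [map_add, add_sub_cancel_left]
    exact hT u h
  choose S hS using fun f : StrongDual ℝ Y =>
    exists_eq_of_stronglyMonotone hX (hA_diff.continuous.add hF_cont) hc hB (ι f)
  choose K hK using fun u : X =>
    exists_continuousLinearMap_rightInverse_of_coercive hX (fderiv ℝ A u + GF u) hc (hT u)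
  refine ⟨S, fun f => (K (S f)).comp ι, fun f => ⟨hS f, fun v hv => ?_⟩,
    fun f h => ⟨hK (S f) (ι h), fun w hw => ?_⟩,
    hasNewtonDerivative_of_forall_norm_le fun f ε hε => ?_⟩
  · exact eq_of_stronglyMonotone (B := A + F) hc hB (hv.trans (hS f).symm)
  · exact eq_of_stronglyMonotone hc (hT' (S f)) (hw.trans (hK (S f) (ι h)).symm)
  have hlip : ∀ h, ‖S (f + h) - S f‖ ≤ c⁻¹ * ‖ι‖ * ‖h‖ := fun h => by
    have h1 := hB (S f) (S (f + h) - S f)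
    have h2 : A (S (f + h)) + F (S (f + h)) - (A (S f) + F (S f)) = ι h := by
      have e1 : A (S (f + h)) + F (S (f + h)) = ι (f + h) := hS (f + h)
      have e2 : A (S f) + F (S f) = ι f := hS f
      rw [e1, e2, map_add, add_sub_cancel_left]
    rw [add_sub_cancel, h2] at h1
    rw [mul_assoc]
    exact (norm_le_div_of_mul_sq_le_apply hc h1).trans
      (mul_le_mul_of_nonneg_left (ι.le_opNorm h) (inv_nonneg.2 hc.le))
  have hlim : Tendsto (fun h => S (f + h) - S f) (𝓝 0) (𝓝 0) := by
    refine squeeze_zero_norm hlip ?_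
    have : Continuous fun h : StrongDual ℝ Y => c⁻¹ * ‖ι‖ * ‖h‖ := by fun_prop
    simpa using this.tendsto 0
  -- Two remainders of size `δ * ‖k‖`, the Lipschitz constant `c⁻¹ * ‖ι‖` of `S`, and another `c⁻¹`
  -- from inverting the linearization; the `+ 1` covers `ι = 0`.
  obtain ⟨δ, hδ, hδε⟩ : ∃ δ : ℝ, 0 < δ ∧ c⁻¹ * (2 * δ * (c⁻¹ * ‖ι‖)) ≤ ε := by
    refine ⟨ε * c ^ 2 / (2 * (‖ι‖ + 1)), by positivity, ?_⟩
    have e : c⁻¹ * (2 * (ε * c ^ 2 / (2 * (‖ι‖ + 1))) * (c⁻¹ * ‖ι‖)) =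
        ε * (‖ι‖ / (‖ι‖ + 1)) := by
      field_simp
    rw [e]
    exact mul_le_of_le_one_right hε.le (div_le_one_of_le₀ (by linarith) (by positivity))
  filter_upwards [hlim.eventually (hA_diff.hasNewtonDerivative_fderiv.exists_forall_norm_le (S f) hδ),
    hlim.eventually (hF_newton.exists_forall_norm_le (S f) hδ)] with h h1 h2
  rw [add_sub_cancel] at h1 h2
  set k := S (f + h) - S f with hk
  set u := S (f + h) with hu
  have hres : (fderiv ℝ A u + GF u) (k - K u (ι h)) =
      -((A u - A (S f) - fderiv ℝ A u k) + (F u - F (S f) - GF u k)) := by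
    have e1 : A u + F u = ι (f + h) := hS (f + h)
    have e2 : A (S f) + F (S f) = ι f := hS f
    have e3 : ι h = A u + F u - (A (S f) + F (S f)) := by
      rw [e1, e2, map_add, add_sub_cancel_left]
    rw [map_sub, hK, add_apply, e3]
    abel
  have h3 := norm_le_div_of_mul_sq_le_apply hc (hT u (k - K u (ι h)))
  rw [hres, norm_neg] at h3
  have h4 : ‖(A u - A (S f) - fderiv ℝ A u k) + (F u - F (S f) - GF u k)‖ ≤
      2 * δ * (c⁻¹ * ‖ι‖) * ‖h‖ := by
    have := mul_le_mul_of_nonneg_left (hlip h) (mul_pos two_pos hδ).le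
    have h5 := norm_add_le (A u - A (S f) - fderiv ℝ A u k) (F u - F (S f) - GF u k)
    linarith
  calc ‖k - (K u).comp ι h‖ ≤ c⁻¹ * (2 * δ * (c⁻¹ * ‖ι‖) * ‖h‖) :=
        h3.trans (mul_le_mul_of_nonneg_left h4 (inv_nonneg.2 hc.le))
    _ = c⁻¹ * (2 * δ * (c⁻¹ * ‖ι‖)) * ‖h‖ := by ring
    _ ≤ ε * ‖h‖ := mul_le_mul_of_nonneg_right hδε (norm_nonneg h)
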